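/- Let $d\ge k\ge 1$ be integers and $[d]=\{1,\dots,d\}$. A $(d,k)$-direction is a subset $\pi\subseteq[d]$ of cardinality $k$; let $\Pi_{d,k}$ be the set of $(d,k)$-directions. A non-empty non-ambiguous tree of dimension $(d,k)$ is a finite rooted tree in which the children of each vertex are indexed by distinct elements of $\Pi_{d,k}$, together with a labelling such that (1) a child of index $\pi$ is labelled by a $d$-tuple with entries in $\mathbb N\cup\{\bullet\}$ whose entries different from $\bullet$ are exactly those at the positions $i\in\pi$, and the root is labelled by a tuple in $\mathbb N^d$; (2) if $U$ is a proper descendant of $V$ and the $i$-th entries of $U$ and $V$ both differ from $\bullet$, then the $i$-th entry of $V$ is strictly greater than that of $U$; (3) for each $i\in[d]$, the $i$-th entries different from $\bullet$ of the various vertices are pairwise distinct; (4) for each $i\in[d]$, the set of the $i$-th entries different from $\bullet$ is an integer interval with minimum $1$. The geometric size $(w_1(T),\dots,w_d(T))$ of such a tree $T$ is the label of its root. In addition there is, for each $\pi\in\Pi_{d,k}$, one empty tree $\emptyset_\pi$, with $w_i(\emptyset_\pi)=0$ if $i\in\pi$ and $w_i(\emptyset_\pi)=1$ if $i\notin\pi$.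 Let $NAT_{d,k}$ be the set of all these trees, including the empty ones. For $S=\{i_1,\dots,i_r\}\subseteq[d]$ put $x_S=x_{i_1}\cdots x_{i_r}$, $\partial_S=\partial_{i_1}\cdots\partial_{i_r}$ and $\int_S=\int_0^{x_{i_1}}\cdots\int_0^{x_{i_r}}$, acting on $\mathbb Q[[x_1,\dots,x_d]]$. Then for every $m\in\mathbb N^d$ only finitely many $T\in NAT_{d,k}$ have geometric size $m$, so that $$L=\sum_{T\in NAT_{d,k}}\ \prod_{i=1}^d\frac{x_i^{w_i(T)}}{w_i(T)!}\in\mathbb Q[[x_1,\dots,x_d]]$$ is well defined. It satisfies $$L=\sum_{\pi\in\Pi_{d,k}}x_{[d]\setminus\pi}+\int_{[d]}\ \prod_{\pi\in\Pi_{d,k}}\partial_{[d]\setminus\pi}L ,$$ and its full mixed derivative $G=\partial_{[d]}L$ satisfies $$G=\prod_{\pi\in\Pi_{d,k}}\Bigl(1+\int_\pi G\Bigr).$$ -/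

import Mathlib

namespace NATdk

/-- A `(d,k)`-direction: a subset of cardinality `k` of `{1, …, d}`. -/
abbrev Dir (d k : ℕ) : Type := {s : Finset (Fin d) // s.card = k}

/-- A vertex of a tree whose children are indexed by `(d,k)`-directions is the word of the
indices met on the path from the root to it. The direction of a vertex other than the root is its
own index, the last letter of the word; the root carries a full `d`-tuple. -/
def dirOf {d k : ℕ} (v : List (Dir d k)) : Finset (Fin d) :=
  match v.getLast? with
  | none => Finset.univ
  | some π => π.1

/-- A (non-empty) non-ambiguous tree of dimension `(d,k)`. The entry `none` of a label is the
symbol `•`; outside of the set of vertices the label is set to the constant `none`. -/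
@[ext]
structure NAT (d k : ℕ) where
  /-- the vertices -/
  verts : Finset (List (Dir d k))
  /-- `label v i` is the `i`-th component of the label of `v` -/
  label : List (Dir d k) → Fin d → Option ℕ
  root_mem : [] ∈ verts
  parent_mem : ∀ v π, v ++ [π] ∈ verts → v ∈ verts
  label_isSome : ∀ v i, (label v i).isSome ↔ v ∈ verts ∧ i ∈ dirOf v
  /-- labels strictly decrease, componentwise, from a vertex `v` to a proper descendant `u` -/
  decreasing : ∀ v ∈ verts, ∀ u ∈ verts, v <+: u → v ≠ u →
    ∀ i a b, label v i = some a → label u i = some b → b < a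
  distinct : ∀ v ∈ verts, ∀ u ∈ verts, v ≠ u →
    ∀ i a b, label v i = some a → label u i = some b → a ≠ b
  interval : ∀ i, ∃ n, {a | ∃ v ∈ verts, label v i = some a} = Set.Icc 1 n

/-- Non-ambiguous trees of dimension `(d,k)`, including one empty tree of each direction. -/
inductive GNAT (d k : ℕ) : Type
  | empty (π : Dir d k) : GNAT d k
  | nonempty (T : NAT d k) : GNAT d k

/-- The geometric size: the label of the root, and by convention `0` (for `i ∈ π`) or `1`
(for `i ∉ π`) for the empty tree of direction `π`. -/
def GNAT.size {d k : ℕ} : GNAT d k → Fin d → ℕ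
  | .empty π, i => if i ∈ π.1 then 0 else 1
  | .nonempty T, i => (T.label [] i).getD 0

open MvPowerSeries in
/-- The weight `∏ i, x_i ^ (w_i) / (w_i)!` of a tree of geometric size `w`. -/
noncomputable def weight {d k : ℕ} (T : GNAT d k) : MvPowerSeries (Fin d) ℚ :=
  ∏ i, (C ((T.size i).factorial : ℚ)⁻¹ * X i ^ T.size i)

/-- The exponential generating function `∑ T, weight T`, summed coefficient by coefficient. -/
noncomputable def L (d k : ℕ) : MvPowerSeries (Fin d) ℚ :=
  fun m => ∑ᶠ T : GNAT d k, MvPowerSeries.coeff m (weight T)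

/-- The formal integral `∫_0^{x_i}`. -/
noncomputable def integ {d : ℕ} (i : Fin d) (f : MvPowerSeries (Fin d) ℚ) :
    MvPowerSeries (Fin d) ℚ :=
  fun m => if m i = 0 then 0
    else MvPowerSeries.coeff (m - Finsupp.single i 1) f / (m i : ℚ)

/-- `∂_{i_1} ⋯ ∂_{i_r}` for `S = {i_1 < ⋯ < i_r}`. -/
noncomputable def partialS {d : ℕ} (S : Finset (Fin d)) (f : MvPowerSeries (Fin d) ℚ) :
    MvPowerSeries (Fin d) ℚ :=
  (S.sort (· ≤ ·)).foldr (fun i g => MvPowerSeries.pderiv ℚ i g) f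

/-- `∫_0^{x_{i_1}} ⋯ ∫_0^{x_{i_r}}` for `S = {i_1 < ⋯ < i_r}`. -/
noncomputable def integS {d : ℕ} (S : Finset (Fin d)) (f : MvPowerSeries (Fin d) ℚ) :
    MvPowerSeries (Fin d) ℚ :=
  (S.sort (· ≤ ·)).foldr integ f

/-- The full mixed derivative `∂_1 ⋯ ∂_d L`. -/
noncomputable def G (d k : ℕ) : MvPowerSeries (Fin d) ℚ :=
  partialS Finset.univ (L d k)

end NATdk

/-! Fix the vertex set `S` of a non-empty tree. Labels in different coordinates are independent, and
the `i`-th labels amount to a linear extension of the descendant order on the vertices having an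
`i`-th label. The root gets the largest label, so the geometric size depends on `S` only, and the
factorials in the weight turn the number of labellings into a product over `i` of proportions `rho`
of linear extensions among all total orders. These proportions multiply over disjoint unions
(`rho_sigma`), and a maximum divides them by the cardinality (`rho_top`).

Deleting the root of a tree of size `m` thus costs the factor `∏ 1 / m_i`, which is the effect of
`∫_[d]`, and leaves one possibly empty subtree for each direction `π`, whose root is labelled in `π`
only. Forgetting the root labels outside `π` is the effect of `∂_{[d]∖π}`, and `∅_π` supplies the
constant term `1` (`coeff_partialS_L`). Multiplying over `π` gives the equation of `L`.

Since `k ≥ 1`, `∂_[d]` kills the monomials of the empty trees, so `G = ∏ ∂_{[d]∖π} L`. Each factor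
is `1 + ∫_π G`, because its non-constant monomials involve every variable of `π`. -/

namespace NATdk

/-! ### Proportions of linear extensions -/

section LinearExtensions

variable {P Q : Type*}

/-- The bijections of `P` with `Fin n` that are strictly increasing for the relation `r`. -/
abbrev Increasing (r : P → P → Prop) (n : ℕ) : Type _ :=
  {σ : P ≃ Fin n // ∀ u v, r u v → σ u < σ v}

/-- The number of linear extensions of the relation `r`. -/
noncomputable def linExt (r : P → P → Prop) : ℕ := Nat.card (Increasing r (Nat.card P))

theorem linExt_eq (r : P → P → Prop) {n : ℕ} (h : Nat.card P = n) :
    linExt r = Nat.card (Increasing r n) := by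
  subst h; rfl

/-- The proportion of linear extensions among all total orders. -/
noncomputable def rho (r : P → P → Prop) : ℚ := linExt r / (Nat.card P).factorial

theorem linExt_congr {r : P → P → Prop} {s : Q → Q → Prop} (e : P ≃ Q)
    (h : ∀ u v, r u v ↔ s (e u) (e v)) : linExt r = linExt s := by
  rw [linExt_eq r (Nat.card_congr e), linExt]
  refine Nat.card_congr ((Equiv.equivCongr e (Equiv.refl _)).subtypeEquiv fun σ => ?_)
  constructor
  · intro H u v huv
    simpa using H (e.symm u) (e.symm v) ((h _ _).2 (by simpa using huv))
  · intro H u v huv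
    simpa using H (e u) (e v) ((h _ _).1 huv)

theorem rho_congr {r : P → P → Prop} {s : Q → Q → Prop} (e : P ≃ Q)
    (h : ∀ u v, r u v ↔ s (e u) (e v)) : rho r = rho s := by
  rw [rho, rho, linExt_congr e h, Nat.card_congr e]

theorem card_equiv_fin [Finite P] {n : ℕ} (h : Nat.card P = n) :
    Nat.card (P ≃ Fin n) = n.factorial := by
  classical
  have := Fintype.ofFinite P
  have e : P ≃ Fin n := Fintype.equivFinOfCardEq (by rw [← h, Nat.card_eq_fintype_card])
  rw [Nat.card_eq_fintype_card, Fintype.card_equiv e, ← Nat.card_eq_fintype_card, h]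

theorem exists_equiv_fin_lt_iff [Finite P] {β : Type*} [LinearOrder β] {n : ℕ}
    (h : Nat.card P = n) {f : P → β} (hf : Function.Injective f) :
    ∃ e : P ≃ Fin n, ∀ u v, f u < f v ↔ e u < e v := by
  have := Fintype.ofFinite P
  let _ : LinearOrder P := LinearOrder.lift' f hf
  have e := Fintype.orderIsoFinOfCardEq P (k := n) (by rw [← h, Nat.card_eq_fintype_card])
  exact ⟨e.symm.toEquiv, fun u v => (e.symm.lt_iff_lt (x := u) (y := v)).symm⟩

/-- Only the order that `f` induces on `P` matters. This form applies to the restriction of a total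
order to a part, whose values need not be consecutive. -/
theorem card_perm_increasing [Finite P] (r : P → P → Prop) {β : Type*} [LinearOrder β]
    {f : P → β} (hf : Function.Injective f) :
    Nat.card {g : Equiv.Perm P // ∀ u v, r u v → f (g u) < f (g v)} = linExt r := by
  obtain ⟨e, he⟩ := exists_equiv_fin_lt_iff rfl hf
  refine Nat.card_congr ((Equiv.equivCongr (Equiv.refl _) e).subtypeEquiv fun g => ?_)
  simp [he]

variable {ι : Type*} [Fintype ι] {R : ι → Type*} [∀ j, Finite (R j)]

/-- Double counting of the pairs of a total order `σ` of the union and a family `g` of permutations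
of the parts such that `σ ∘ g` is increasing. For fixed `g`, composition with `g` identifies the
admissible `σ` with the linear extensions; for fixed `σ`, the conditions on the `g j` are
independent. -/
theorem linExt_sigma {s : ∀ j, R j → R j → Prop} {r : (Σ j, R j) → (Σ j, R j) → Prop}
    (h₁ : ∀ j u v, r ⟨j, u⟩ ⟨j, v⟩ ↔ s j u v)
    (h₂ : ∀ j k u v, r ⟨j, u⟩ ⟨k, v⟩ → j = k) :
    linExt r * ∏ j, (Nat.card (R j)).factorial =
      (Nat.card (Σ j, R j)).factorial * ∏ j, linExt (s j) := by
  classical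
  have := fun j => Fintype.ofFinite (R j)
  set N := Nat.card (Σ j, R j) with hN
  let comp (σ : (Σ j, R j) ≃ Fin N) (g : ∀ j, Equiv.Perm (R j)) : Prop :=
    ∀ j u v, s j u v → σ ⟨j, g j u⟩ < σ ⟨j, g j v⟩
  have hcomp : ∀ σ g, (∀ u v, r u v → (Equiv.sigmaCongrRight g).trans σ u <
      (Equiv.sigmaCongrRight g).trans σ v) ↔ comp σ g := by
    intro σ g
    constructor
    · intro H j u v huv
      exact H ⟨j, u⟩ ⟨j, v⟩ ((h₁ j u v).2 huv)
    · rintro H ⟨j, u⟩ ⟨k, v⟩ huv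
      obtain rfl := h₂ _ _ _ _ huv
      exact H j u v ((h₁ j u v).1 huv)
  have e₁ : {p : (∀ j, Equiv.Perm (R j)) × ((Σ j, R j) ≃ Fin N) // comp p.2 p.1} ≃
      (∀ j, Equiv.Perm (R j)) × Increasing r N := by
    refine (Equiv.subtypeProdEquivSigmaSubtype fun g σ => comp σ g).trans
      ((Equiv.sigmaCongrRight fun g => ?_).trans (Equiv.sigmaEquivProd _ _))
    exact (Equiv.equivCongr (Equiv.sigmaCongrRight g).symm (Equiv.refl _)).subtypeEquiv
      fun σ => (hcomp σ g).symm
  have e₂ : {p : ((Σ j, R j) ≃ Fin N) × (∀ j, Equiv.Perm (R j)) // comp p.1 p.2} ≃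
      Σ σ : (Σ j, R j) ≃ Fin N, ∀ j, {g : Equiv.Perm (R j) //
        ∀ u v, s j u v → σ ⟨j, g u⟩ < σ ⟨j, g v⟩} :=
    (Equiv.subtypeProdEquivSigmaSubtype comp).trans
      (Equiv.sigmaCongrRight fun σ => Equiv.subtypePiEquivPi
        (p := fun j (g : Equiv.Perm (R j)) => ∀ u v, s j u v → σ ⟨j, g u⟩ < σ ⟨j, g v⟩))
  have e₀ : {p : (∀ j, Equiv.Perm (R j)) × ((Σ j, R j) ≃ Fin N) // comp p.2 p.1} ≃
      {p : ((Σ j, R j) ≃ Fin N) × (∀ j, Equiv.Perm (R j)) // comp p.1 p.2} :=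
    (Equiv.prodComm _ _).subtypeEquiv fun _ => Iff.rfl
  have key := Nat.card_congr (e₁.symm.trans (e₀.trans e₂))
  rw [Nat.card_prod, Nat.card_pi, Nat.card_sigma] at key
  have h₃ : ∀ σ : (Σ j, R j) ≃ Fin N, Nat.card (∀ j, {g : Equiv.Perm (R j) //
      ∀ u v, s j u v → σ ⟨j, g u⟩ < σ ⟨j, g v⟩}) = ∏ j, linExt (s j) := by
    intro σ
    rw [Nat.card_pi]
    exact Finset.prod_congr rfl fun j _ => card_perm_increasing (s j)
      (f := fun u => σ ⟨j, u⟩) (σ.injective.comp sigma_mk_injective)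
  simp only [h₃, Finset.sum_const, Finset.card_univ, smul_eq_mul, ← Nat.card_eq_fintype_card,
    card_equiv_fin hN.symm, Nat.card_perm] at key
  rw [← key, mul_comm, linExt]

theorem rho_sigma {s : ∀ j, R j → R j → Prop} {r : (Σ j, R j) → (Σ j, R j) → Prop}
    (h₁ : ∀ j u v, r ⟨j, u⟩ ⟨j, v⟩ ↔ s j u v)
    (h₂ : ∀ j k u v, r ⟨j, u⟩ ⟨k, v⟩ → j = k) : rho r = ∏ j, rho (s j) := by
  have h := linExt_sigma h₁ h₂
  simp only [rho, Finset.prod_div_distrib]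
  rw [div_eq_div_iff (by positivity) (Finset.prod_ne_zero_iff.2 fun j _ => by positivity)]
  rw [mul_comm (∏ j, (linExt (s j) : ℚ))]
  exact_mod_cast h

/-- A maximum is forced to take the last value, and puts no constraint on the order of the rest. -/
theorem linExt_top [Finite P] {r : P → P → Prop} {s : Q → Q → Prop} (e : Option Q ≃ P)
    (h : ∀ u v, r (e (some u)) (e (some v)) ↔ s u v)
    (h₁ : ∀ u, r (e (some u)) (e none)) (h₂ : ∀ x, ¬ r (e none) x) : linExt r = linExt s := by
  have : Finite Q := Finite.of_injective (fun q => e (some q))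
    (e.injective.comp (Option.some_injective _))
  have hc : Nat.card P = Nat.card Q + 1 := by
    rw [← Nat.card_congr e, Finite.card_option]
  rw [linExt_eq r hc, linExt]
  symm
  let Φ (σ : Q ≃ Fin (Nat.card Q)) : P ≃ Fin (Nat.card Q + 1) :=
    e.symm.trans (σ.optionCongr.trans finSuccEquivLast.symm)
  have hΦs : ∀ σ u, Φ σ (e (some u)) = (σ u).castSucc := by intro σ u; simp [Φ]
  have hΦn : ∀ σ, Φ σ (e none) = Fin.last _ := by intro σ; simp [Φ]
  refine Nat.card_congr (Equiv.ofBijective (fun σ => ⟨Φ σ.1, ?_⟩) ⟨?_, ?_⟩)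
  · intro u v huv
    obtain ⟨u, rfl⟩ := e.surjective u
    obtain ⟨v, rfl⟩ := e.surjective v
    rcases u with _ | u
    · exact absurd huv (h₂ _)
    rcases v with _ | v
    · rw [hΦs, hΦn]; exact Fin.castSucc_lt_last _
    · rw [hΦs, hΦs]; exact Fin.castSucc_lt_castSucc_iff.2 (σ.2 _ _ ((h _ _).1 huv))
  · intro σ τ hστ
    ext u : 3
    have := congrArg (fun f => f.1 (e (some u))) hστ
    simp only [hΦs] at this
    exact congrArg _ (Fin.castSucc_injective _ this)
  · intro σ
    have hlast : σ.1 (e none) = Fin.last _ := by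
      by_contra hne
      obtain ⟨x, hx⟩ := e.surjective (σ.1.symm (Fin.last _))
      rcases x with _ | u
      · exact hne (by rw [hx]; simp)
      · have := σ.2 _ _ (h₁ u)
        rw [hx, Equiv.apply_symm_apply] at this
        exact absurd this (Fin.le_last _).not_gt
    -- As `σ` sends the maximum to the last value, `τ` fixes `none`, and removing `none` leaves the
    -- required order on `Q`.
    let τ : Option Q ≃ Option (Fin (Nat.card Q)) := e.trans (σ.1.trans finSuccEquivLast)
    have hτ : τ none = none := by simp [τ, hlast]
    have hτs : ∀ u, some (τ.removeNone u) = τ (some u) := by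
      intro u
      refine Equiv.removeNone_some τ (Option.ne_none_iff_exists'.1 fun hu => ?_)
      exact absurd (τ.injective (hu.trans hτ.symm)) (by simp)
    have hσ : ∀ u, ((τ.removeNone u).castSucc) = σ.1 (e (some u)) := by
      intro u
      have := congrArg finSuccEquivLast.symm (hτs u)
      simpa [τ] using this
    refine ⟨⟨τ.removeNone, fun u v huv => ?_⟩, ?_⟩
    · rw [← Fin.castSucc_lt_castSucc_iff, hσ, hσ]
      exact σ.2 _ _ ((h _ _).2 huv)
    · ext x : 2
      obtain ⟨x, rfl⟩ := e.surjective x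
      rcases x with _ | u
      · exact (hΦn _).trans hlast.symm
      · exact (hΦs _ _).trans (hσ u)

theorem rho_top [Finite P] {r : P → P → Prop} {s : Q → Q → Prop} (e : Option Q ≃ P)
    (h : ∀ u v, r (e (some u)) (e (some v)) ↔ s u v)
    (h₁ : ∀ u, r (e (some u)) (e none)) (h₂ : ∀ x, ¬ r (e none) x) :
    rho r = rho s / Nat.card P := by
  have : Finite Q := Finite.of_injective (fun q => e (some q))
    (e.injective.comp (Option.some_injective _))
  have hc : Nat.card P = Nat.card Q + 1 := by
    rw [← Nat.card_congr e, Finite.card_option]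
  rw [rho, rho, linExt_top e h h₁ h₂, hc, Nat.factorial_succ, div_div]
  push_cast
  rw [mul_comm]

end LinearExtensions

end NATdk

namespace NATdk

/-! ### Decreasing labellings of sets of words -/

section Words

variable {α : Type*}

/-- The word `u` is a proper descendant of the word `v`. -/
def Desc (A : Set (List α)) (u v : A) : Prop := v.1 <+: u.1 ∧ v.1 ≠ u.1

/-- The proportion of decreasing labellings of a set of words. -/
noncomputable def rhoWords (A : Set (List α)) : ℚ := rho (Desc A)

theorem rhoWords_of_nil_mem {A : Set (List α)} (hA : A.Finite) (h : [] ∈ A) :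
    rhoWords A = rhoWords (A \ {[]}) / A.ncard := by
  classical
  have := hA.to_subtype
  let t : A := ⟨[], h⟩
  let e₀ : ↥(A \ {[]}) ≃ {u : A // u ≠ t} :=
    { toFun := fun u => ⟨⟨u.1, u.2.1⟩, fun hu => u.2.2 (congrArg Subtype.val hu)⟩
      invFun := fun u => ⟨u.1.1, u.1.2, fun hu => u.2 (Subtype.ext hu)⟩
      left_inv := fun _ => rfl
      right_inv := fun _ => rfl }
  let e : Option ↥(A \ {[]}) ≃ A := e₀.optionCongr.trans (Equiv.optionSubtypeNe t)
  refine rho_top e (fun u v => Iff.rfl) (fun u => ⟨List.nil_prefix, ?_⟩) (fun x hx => ?_)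
  · exact fun hu => u.2.2 hu.symm
  · exact hx.2 (List.prefix_nil.1 hx.1)

/-- A set of non-empty words is partitioned according to the first letter. -/
def wordsEquivSigma {A : Set (List α)} (h : [] ∉ A) : A ≃ Σ a, {v | a :: v ∈ A} where
  toFun u := match u with
    | ⟨[], hu⟩ => absurd hu h
    | ⟨a :: v, hu⟩ => ⟨a, v, hu⟩
  invFun p := ⟨p.1 :: p.2.1, p.2.2⟩
  left_inv u := match u with
    | ⟨[], hu⟩ => absurd hu h
    | ⟨_ :: _, _⟩ => rfl
  right_inv _ := rfl

theorem finite_tails {A : Set (List α)} (hA : A.Finite) (a : α) : {v | a :: v ∈ A}.Finite :=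
  hA.preimage (List.cons_injective (a := a)).injOn

/-- A non-empty word and its descendants share their first letter, so the descendant order is the
disjoint union of its parts by first letter. -/
theorem rhoWords_of_nil_notMem [Fintype α] {A : Set (List α)} (hA : A.Finite) (h : [] ∉ A) :
    rhoWords A = ∏ a, rhoWords {v | a :: v ∈ A} := by
  have := fun a => (finite_tails hA a).to_subtype
  rw [rhoWords, ← rho_congr (r := fun u v => Desc A ((wordsEquivSigma h).symm u)
    ((wordsEquivSigma h).symm v)) (wordsEquivSigma h).symm (fun _ _ => Iff.rfl)]
  refine rho_sigma (fun a u v => ?_) (fun a b u v huv => ?_)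
  · simp [wordsEquivSigma, Desc]
  · exact (List.cons_prefix_cons.1 huv.1).1.symm

theorem ncard_of_nil_notMem [Fintype α] {A : Set (List α)} (hA : A.Finite) (h : [] ∉ A) :
    A.ncard = ∑ a, {v | a :: v ∈ A}.ncard := by
  have := fun a => (finite_tails hA a).to_subtype
  rw [← Nat.card_coe_set_eq, Nat.card_congr (wordsEquivSigma h), Nat.card_sigma]
  rfl

end Words

/-! ### Shapes of trees, their sizes and weights -/

variable {d k : ℕ}

/-- A finite prefix-closed set of words, possibly empty: the vertices of a tree. -/
def IsShape (S : Finset (List (Dir d k))) : Prop := ∀ v π, v ++ [π] ∈ S → v ∈ S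

theorem IsShape.mem_of_append {S : Finset (List (Dir d k))} (hS : IsShape S) {u : List (Dir d k)} :
    ∀ v : List (Dir d k), u ++ v ∈ S → u ∈ S := by
  intro v
  induction v using List.reverseRecOn with
  | nil => simp
  | append_singleton v π ih =>
    intro h
    exact ih (hS _ π (by simpa using h))

theorem IsShape.nil_mem {S : Finset (List (Dir d k))} (hS : IsShape S) (h : S.Nonempty) :
    [] ∈ S := by
  obtain ⟨v, hv⟩ := h
  exact hS.mem_of_append v (by simpa using hv)

/-- The vertices of a full tree having an `i`-th label. -/
def full (S : Finset (List (Dir d k))) (i : Fin d) : Set (List (Dir d k)) :=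
  {v | v ∈ S ∧ i ∈ dirOf v}

/-- The vertices of a tree having an `i`-th label when its root is a child of index `π`. -/
def hung (π : Dir d k) (S : Finset (List (Dir d k))) (i : Fin d) : Set (List (Dir d k)) :=
  {v | v ∈ S ∧ i ∈ dirOf (π :: v)}

theorem finite_full (S : Finset (List (Dir d k))) (i : Fin d) : (full S i).Finite :=
  S.finite_toSet.subset fun _ h => h.1

theorem finite_hung (π : Dir d k) (S : Finset (List (Dir d k))) (i : Fin d) :
    (hung π S i).Finite :=
  S.finite_toSet.subset fun _ h => h.1

theorem dirOf_nil : dirOf ([] : List (Dir d k)) = Finset.univ := rfl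

theorem dirOf_cons_nil (π : Dir d k) : dirOf [π] = π.1 := rfl

theorem dirOf_cons (π : Dir d k) {v : List (Dir d k)} (hv : v ≠ []) : dirOf (π :: v) = dirOf v := by
  obtain ⟨π', w, rfl⟩ := List.exists_cons_of_ne_nil hv
  simp [dirOf, List.getLast?_cons_cons]

theorem nil_mem_full {S : Finset (List (Dir d k))} (h : [] ∈ S) (i : Fin d) : [] ∈ full S i :=
  ⟨h, by simp [dirOf_nil]⟩

theorem hung_of_mem {π : Dir d k} (S : Finset (List (Dir d k))) {i : Fin d} (hi : i ∈ π.1) :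
    hung π S i = full S i := by
  ext v
  rcases eq_or_ne v [] with rfl | hv
  · simp [hung, full, dirOf_nil, dirOf_cons_nil, hi]
  · simp [hung, full, dirOf_cons π hv]

theorem hung_of_notMem {π : Dir d k} (S : Finset (List (Dir d k))) {i : Fin d} (hi : i ∉ π.1) :
    hung π S i = full S i \ {[]} := by
  ext v
  rcases eq_or_ne v [] with rfl | hv
  · simp [hung, dirOf_cons_nil, hi]
  · simp [hung, full, dirOf_cons π hv, hv]

/-- The subtree hanging at the child of index `π` of the root. -/
noncomputable def subtree (S : Finset (List (Dir d k))) (π : Dir d k) : Finset (List (Dir d k)) :=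
  S.preimage (List.cons π) List.cons_injective.injOn

@[simp] theorem mem_subtree {S : Finset (List (Dir d k))} {π : Dir d k} {v : List (Dir d k)} :
    v ∈ subtree S π ↔ π :: v ∈ S := Finset.mem_preimage

/-- Cutting off the first letter turns `[π]` into `[]`, to which `dirOf` assigns all of `Fin d`.
Hence subtrees are measured with `hung`, which remembers the lost index. -/
theorem tails_full (S : Finset (List (Dir d k))) (i : Fin d) (π : Dir d k) :
    {v | π :: v ∈ full S i \ {[]}} = hung π (subtree S π) i := by
  ext v
  simp [full, hung]

/-- The number of `i`-th labels of a full tree. -/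
noncomputable def fullSize (S : Finset (List (Dir d k))) : Fin d →₀ ℕ :=
  Finsupp.equivFunOnFinite.symm fun i => (full S i).ncard

/-- The number of `i`-th labels of a tree whose root is a child of index `π`. -/
noncomputable def hungSize (π : Dir d k) (S : Finset (List (Dir d k))) : Fin d →₀ ℕ :=
  Finsupp.equivFunOnFinite.symm fun i => (hung π S i).ncard

/-- The proportion of decreasing labellings of a full tree. -/
noncomputable def fullWt (S : Finset (List (Dir d k))) : ℚ := ∏ i, rhoWords (full S i)

/-- The proportion of decreasing labellings of a tree whose root is a child of index `π`. -/
noncomputable def hungWt (π : Dir d k) (S : Finset (List (Dir d k))) : ℚ :=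
  ∏ i, rhoWords (hung π S i)

theorem ncard_full_eq {S : Finset (List (Dir d k))} (h : [] ∈ S) (i : Fin d) :
    (full S i).ncard = (full S i \ {[]}).ncard + 1 :=
  (Set.ncard_sdiff_singleton_add_one (nil_mem_full h i) (finite_full S i)).symm

theorem fullSize_eq_sum {S : Finset (List (Dir d k))} (h : [] ∈ S) :
    fullSize S = (∑ π, hungSize π (subtree S π)) + Finsupp.equivFunOnFinite.symm 1 := by
  ext i
  have : (full S i).ncard = (∑ π, (hung π (subtree S π) i).ncard) + 1 := by
    rw [ncard_full_eq h, ncard_of_nil_notMem ((finite_full S i).subset Set.sdiff_subset) (by simp)]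
    simp only [tails_full]
  simpa [fullSize, hungSize, Finsupp.finsetSum_apply] using this

theorem fullSize_eq_hungSize {S : Finset (List (Dir d k))} (h : [] ∈ S) (π : Dir d k) (i : Fin d) :
    fullSize S i = hungSize π S i + if i ∈ π.1 then 0 else 1 := by
  change (full S i).ncard = (hung π S i).ncard + _
  split_ifs with hi
  · rw [hung_of_mem S hi, add_zero]
  · rw [hung_of_notMem S hi, ncard_full_eq h]

theorem fullSize_ne_zero {S : Finset (List (Dir d k))} (h : [] ∈ S) (i : Fin d) :
    fullSize S i ≠ 0 := by
  change (full S i).ncard ≠ 0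
  rw [ncard_full_eq h]; omega

/-- In each coordinate the root is a maximum and the rest splits over the children. This is the
combinatorial counterpart of `∫_[d] ∏`. -/
theorem fullWt_eq_prod {S : Finset (List (Dir d k))} (h : [] ∈ S) :
    fullWt S = (∏ π, hungWt π (subtree S π)) / ∏ i, (fullSize S i : ℚ) := by
  simp only [fullWt, hungWt]
  rw [Finset.prod_comm, ← Finset.prod_div_distrib]
  refine Finset.prod_congr rfl fun i _ => ?_
  rw [rhoWords_of_nil_mem (finite_full S i) (nil_mem_full h i),
    rhoWords_of_nil_notMem ((finite_full S i).subset Set.sdiff_subset) (by simp)]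
  simp only [tails_full]
  rfl

/-- The two orders differ only by the root, in the coordinates outside `π`; each such coordinate
contributes the factor that the derivative in `x_i` produces. -/
theorem fullWt_eq_hungWt {S : Finset (List (Dir d k))} (h : [] ∈ S) (π : Dir d k) :
    fullWt S * ∏ i ∈ Finset.univ \ π.1, (fullSize S i : ℚ) = hungWt π S := by
  rw [fullWt, hungWt, ← Finset.prod_sdiff (Finset.subset_univ π.1),
    ← Finset.prod_sdiff (Finset.subset_univ π.1) (f := fun i => rhoWords (hung π S i)),
    mul_right_comm, ← Finset.prod_mul_distrib]
  congr 1
  · refine Finset.prod_congr rfl fun i hi => ?_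
    rw [rhoWords_of_nil_mem (finite_full S i) (nil_mem_full h i),
      hung_of_notMem S (by simpa using hi)]
    exact div_mul_cancel₀ _ (Nat.cast_ne_zero.2 (fullSize_ne_zero h i))
  · exact Finset.prod_congr rfl fun i hi => by rw [hung_of_mem S hi]

theorem rhoWords_empty {α : Type*} : rhoWords (∅ : Set (List α)) = 1 := by
  have : Nat.card (Increasing (Desc (∅ : Set (List α))) 0) = 1 := by
    have : Unique (Increasing (Desc (∅ : Set (List α))) 0) :=
      { default := ⟨Equiv.equivOfIsEmpty _ _, fun u => isEmptyElim u⟩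
        uniq := fun σ => Subtype.ext (Subsingleton.elim _ _) }
    exact Nat.card_unique
  rw [rhoWords, rho, linExt_eq _ (n := 0) (by simp), this]
  simp

theorem hungWt_empty (π : Dir d k) : hungWt π ∅ = 1 := by
  have : ∀ i, hung π (∅ : Finset (List (Dir d k))) i = ∅ := by intro i; ext v; simp [hung]
  simp [hungWt, this, rhoWords_empty]

theorem hungSize_empty (π : Dir d k) : hungSize π ∅ = 0 := by
  have : ∀ i, hung π (∅ : Finset (List (Dir d k))) i = ∅ := by intro i; ext v; simp [hung]
  ext i
  simp [hungSize, this]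

/-- As `k ≥ 1`, every vertex carries at least one label. All finiteness statements rest on this
bound. -/
theorem card_le_sum_hungSize (hk : 1 ≤ k) (π : Dir d k) (S : Finset (List (Dir d k))) :
    S.card ≤ ∑ i, hungSize π S i := by
  classical
  have hne : ∀ v : List (Dir d k), (dirOf (π :: v)).Nonempty := by
    intro v
    obtain ⟨π', hπ'⟩ : ∃ π' : Dir d k, dirOf (π :: v) = π'.1 := by
      rw [dirOf, List.getLast?_cons]
      exact ⟨_, rfl⟩
    rw [hπ', ← Finset.card_pos, π'.2]
    omega
  have : (S : Set (List (Dir d k))) ⊆ ⋃ i, hung π S i := fun v hv => by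
    obtain ⟨i, hi⟩ := hne v
    exact Set.mem_iUnion.2 ⟨i, hv, hi⟩
  have h₁ := Set.ncard_le_ncard this (Set.finite_iUnion fun i => finite_hung π S i)
  rw [Set.ncard_coe_finset] at h₁
  exact h₁.trans ((Set.ncard_iUnion_le_of_fintype _))

/-- The prefixes of `v`, including `[]` and `v`, are distinct vertices. -/
theorem IsShape.length_lt {S : Finset (List (Dir d k))} (hS : IsShape S) {v : List (Dir d k)}
    (hv : v ∈ S) : v.length < S.card := by
  have h : (Finset.range (v.length + 1)).card ≤ S.card := by
    refine Finset.card_le_card_of_injOn (fun n => v.take n) (fun n _ => ?_) ?_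
    · exact hS.mem_of_append (v.drop n) (by rwa [List.take_append_drop])
    · intro a ha b hb hab
      have := congrArg List.length hab
      simp only [List.length_take, Finset.coe_range, Set.mem_Iio] at this ha hb
      omega
  simpa using h

theorem finite_hungSize (hk : 1 ≤ k) (π : Dir d k) (n : Fin d →₀ ℕ) :
    {S : Finset (List (Dir d k)) | IsShape S ∧ hungSize π S = n}.Finite := by
  classical
  have hfin := List.finite_length_lt (Dir d k) (∑ i, n i)
  refine (hfin.toFinset.powerset.finite_toSet).subset ?_
  rintro S ⟨hS, rfl⟩
  simp only [Finset.coe_powerset, Set.mem_preimage, Set.mem_powerset_iff]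
  intro v hv
  simpa using (hS.length_lt hv).trans_le (card_le_sum_hungSize hk π S)

theorem hungSize_eq_zero (hk : 1 ≤ k) (π : Dir d k) {S : Finset (List (Dir d k))} :
    hungSize π S = 0 ↔ S = ∅ := by
  constructor
  · intro h
    have := card_le_sum_hungSize hk π S
    simpa [h] using this
  · rintro rfl
    exact hungSize_empty π

theorem finite_fullSize (hk : 1 ≤ k) (hkd : k ≤ d) (n : Fin d →₀ ℕ) :
    {S : Finset (List (Dir d k)) | IsShape S ∧ [] ∈ S ∧ fullSize S = n}.Finite := by
  obtain ⟨s, -, hs⟩ := Finset.exists_subset_card_eq (s := (Finset.univ : Finset (Fin d)))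
    (n := k) (by simpa using hkd)
  let π : Dir d k := ⟨s, hs⟩
  refine (Set.Finite.biUnion (Set.finite_Iic n) fun m _ => finite_hungSize hk π m).subset ?_
  rintro S ⟨hS, h, rfl⟩
  refine Set.mem_biUnion (x := hungSize π S) (fun i => ?_) ⟨hS, rfl⟩
  rw [fullSize_eq_hungSize h π]
  exact Nat.le_add_right _ _

open Classical in
/-- The tree whose root has the given subtrees as children. -/
noncomputable def join (f : Dir d k → Finset (List (Dir d k))) : Finset (List (Dir d k)) :=
  insert [] (Finset.univ.biUnion fun π => (f π).image (List.cons π))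

theorem nil_mem_join (f : Dir d k → Finset (List (Dir d k))) : [] ∈ join f := by
  simp [join]

theorem cons_mem_join {f : Dir d k → Finset (List (Dir d k))} {π : Dir d k}
    {v : List (Dir d k)} : π :: v ∈ join f ↔ v ∈ f π := by
  simp only [join, Finset.mem_insert, reduceCtorEq, Finset.mem_biUnion, Finset.mem_univ, true_and,
    Finset.mem_image, List.cons.injEq, false_or]
  exact ⟨by rintro ⟨_, _, h, rfl, rfl⟩; exact h, fun h => ⟨π, v, h, rfl, rfl⟩⟩

theorem subtree_join (f : Dir d k → Finset (List (Dir d k))) : subtree (join f) = f := by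
  ext π v
  rw [mem_subtree, cons_mem_join]

theorem isShape_join {f : Dir d k → Finset (List (Dir d k))} (hf : ∀ π, IsShape (f π)) :
    IsShape (join f) := by
  rintro (_ | ⟨π, v⟩) π' h
  · exact nil_mem_join f
  · rw [cons_mem_join]
    rw [List.cons_append, cons_mem_join] at h
    exact hf π v π' h

theorem IsShape.subtree {S : Finset (List (Dir d k))} (hS : IsShape S) (π : Dir d k) :
    IsShape (subtree S π) := by
  intro v π' h
  rw [mem_subtree] at h ⊢
  exact hS (π :: v) π' h

/-- The inverse is `join`: the subtrees of the root can be chosen freely, and may be empty. The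
summand `1` counts the labels of the root. -/
theorem bijOn_subtree (m : Fin d →₀ ℕ) :
    Set.BijOn subtree
      {S : Finset (List (Dir d k)) | IsShape S ∧ [] ∈ S ∧
        fullSize S = m + Finsupp.equivFunOnFinite.symm 1}
      {f | (∀ π, IsShape (f π)) ∧ ∑ π, hungSize π (f π) = m} := by
  refine ⟨fun S hS => ⟨hS.1.subtree, ?_⟩, ?_, fun f hf => ?_⟩
  · exact add_right_cancel ((fullSize_eq_sum hS.2.1).symm.trans hS.2.2)
  · intro S hS S' hS' h
    ext (_ | ⟨π, v⟩)
    · exact iff_of_true hS.2.1 hS'.2.1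
    · rw [← mem_subtree, h, mem_subtree]
  · refine ⟨join f, ⟨isShape_join hf.1, nil_mem_join f, ?_⟩, subtree_join f⟩
    rw [fullSize_eq_sum (nil_mem_join f), subtree_join, hf.2]

end NATdk

namespace NATdk

/-! ### Coefficients of products, derivatives and integrals -/

section PowerSeries

open MvPowerSeries

/-- Product rule for generating functions of infinite classes with finitely many objects of each
size. Objects contributing to the exponent `m` have size at most `m`, so all sums can be taken over
one finite set `U`. -/
theorem coeff_prod_of_finite_fibers {ι α σ R : Type*} [Fintype ι] [CommSemiring R]
    {p : α → Prop} {s : ι → α → σ →₀ ℕ} {c : ι → α → R} {F : ι → MvPowerSeries σ R}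
    (hfin : ∀ j n, {a | p a ∧ s j a = n}.Finite)
    (hF : ∀ j n, coeff n (F j) = ∑ᶠ a ∈ {a | p a ∧ s j a = n}, c j a) (m : σ →₀ ℕ) :
    coeff m (∏ j, F j) =
      ∑ᶠ f ∈ {f : ι → α | (∀ j, p (f j)) ∧ ∑ j, s j (f j) = m}, ∏ j, c j (f j) := by
  classical
  have hU : (⋃ j, ⋃ n ∈ Set.Iic m, {a | p a ∧ s j a = n}).Finite :=
    Set.finite_iUnion fun j => (Set.finite_Iic m).biUnion fun n _ => hfin j n
  set U := hU.toFinset with hUdef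
  have memU : ∀ j a, p a → s j a ≤ m → a ∈ U := by
    intro j a ha hle
    simp only [hUdef, Set.Finite.mem_toFinset, Set.mem_iUnion]
    exact ⟨j, s j a, hle, ha, rfl⟩
  have hcoeff : ∀ j n, n ≤ m →
      coeff n (F j) = ∑ a ∈ U, if p a ∧ s j a = n then c j a else 0 := by
    intro j n hn
    rw [hF, ← Finset.sum_filter]
    refine finsum_cond_eq_sum_of_cond_iff _ fun {a} _ => ?_
    simp only [Set.mem_ofPred_eq, Finset.mem_filter]
    refine ⟨fun h => ⟨memU j a h.1 (h.2 ▸ hn), h⟩, fun h => h.2⟩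
  have hrhs : ∑ᶠ f ∈ {f : ι → α | (∀ j, p (f j)) ∧ ∑ j, s j (f j) = m}, ∏ j, c j (f j) =
      ∑ f ∈ (Fintype.piFinset fun _ => U) with (∀ j, p (f j)) ∧ ∑ j, s j (f j) = m,
        ∏ j, c j (f j) := by
    refine finsum_cond_eq_sum_of_cond_iff _ fun {f} _ => ?_
    simp only [Set.mem_ofPred_eq, Finset.mem_filter, Fintype.mem_piFinset]
    refine ⟨fun h => ⟨fun j => memU j _ (h.1 j) ?_, h⟩, fun h => h.2⟩
    rw [← h.2]
    exact Finset.single_le_sum_of_canonicallyOrdered (f := fun j => s j (f j)) (Finset.mem_univ j)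
  rw [hrhs, coeff_prod, Finset.sum_filter]
  have h₁ : ∀ l ∈ Finset.finsuppAntidiag (Finset.univ : Finset ι) m,
      ∏ j, coeff (l j) (F j) = ∑ f ∈ Fintype.piFinset fun _ => U,
        ∏ j, if p (f j) ∧ s j (f j) = l j then c j (f j) else 0 := by
    intro l hl
    rw [Finset.mem_finsuppAntidiag] at hl
    rw [← Finset.prod_univ_sum (fun _ => U)
      fun j a => if p a ∧ s j a = l j then c j a else 0]
    refine Finset.prod_congr rfl fun j _ => hcoeff j _ ?_
    rw [← hl.1]
    exact Finset.single_le_sum_of_canonicallyOrdered (f := fun j => l j) (Finset.mem_univ j)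
  rw [Finset.sum_congr rfl h₁, Finset.sum_comm]
  refine Finset.sum_congr rfl fun f _ => ?_
  -- After exchanging the sums, a choice `f` contributes to a single splitting `l` of `m`, the one
  -- recording the sizes of the `f j`.
  have h₂ : ∀ l : ι →₀ σ →₀ ℕ, (∏ j, if p (f j) ∧ s j (f j) = l j then c j (f j) else 0) =
      if l = Finsupp.equivFunOnFinite.symm (fun j => s j (f j)) then
        (if ∀ j, p (f j) then ∏ j, c j (f j) else 0) else 0 := by
    intro l
    rw [Finset.prod_ite_zero]
    simp only [Finset.mem_univ, true_imp_iff, forall_and]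
    rw [← ite_and]
    refine if_congr ?_ rfl rfl
    rw [and_comm, Finsupp.ext_iff]
    simp [eq_comm]
  simp only [h₂, Finset.sum_ite_eq', Finset.mem_finsuppAntidiag]
  rw [← ite_and]
  refine if_congr ?_ rfl rfl
  simp [and_comm]

variable {d : ℕ}

/-- The exponent of the squarefree monomial `x_A`. -/
noncomputable def ind (A : Finset (Fin d)) : Fin d →₀ ℕ :=
  Finsupp.equivFunOnFinite.symm fun i => if i ∈ A then 1 else 0

@[simp] theorem ind_apply (A : Finset (Fin d)) (i : Fin d) : ind A i = if i ∈ A then 1 else 0 := rfl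

theorem ind_univ : ind (Finset.univ : Finset (Fin d)) = Finsupp.equivFunOnFinite.symm 1 := by
  ext i; simp

theorem ind_insert {A : Finset (Fin d)} {i : Fin d} (h : i ∉ A) :
    ind (insert i A) = Finsupp.single i 1 + ind A := by
  ext j
  rcases eq_or_ne j i with rfl | hj
  · simp [h]
  · simp [hj]

theorem prod_X_eq (A : Finset (Fin d)) :
    ∏ i ∈ A, (X i : MvPowerSeries (Fin d) ℚ) = monomial (ind A) 1 := by
  induction A using Finset.induction_on with
  | empty =>
    have : ind (∅ : Finset (Fin d)) = 0 := by ext; simp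
    rw [Finset.prod_empty, this, monomial_zero_one]
  | insert i A hi ih =>
    rw [Finset.prod_insert hi, ih, ind_insert hi, X_def, monomial_mul_monomial, one_mul]

theorem coeff_partialS (A : Finset (Fin d)) (f : MvPowerSeries (Fin d) ℚ) (n : Fin d →₀ ℕ) :
    coeff n (partialS A f) = coeff (n + ind A) f * ∏ i ∈ A, ((n i : ℚ) + 1) := by
  -- The absence of repetitions means that each variable is differentiated once, so its factor is
  -- unaffected by the other derivatives.
  have key : ∀ l : List (Fin d), l.Nodup → ∀ n : Fin d →₀ ℕ,
      coeff n (l.foldr (fun i g => pderiv ℚ i g) f) =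
        coeff (n + ind l.toFinset) f * ∏ i ∈ l.toFinset, ((n i : ℚ) + 1) := by
    intro l
    induction l with
    | nil =>
      intro _ n
      have : ind (∅ : Finset (Fin d)) = 0 := by ext; simp
      simp [this]
    | cons i l ih =>
      intro hl n
      rw [List.nodup_cons] at hl
      have hi : i ∉ l.toFinset := by simpa using hl.1
      rw [List.foldr_cons, coeff_pderiv, ih hl.2, List.toFinset_cons, ind_insert hi,
        Finset.prod_insert hi, add_assoc, mul_assoc]
      congr 1
      rw [mul_comm]
      congr 1
      refine Finset.prod_congr rfl fun j hj => ?_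
      have : i ≠ j := fun h => hi (h ▸ hj)
      simp [this]
  rw [partialS, key _ (Finset.sort_nodup _ _), Finset.sort_toFinset]

theorem coeff_integS (A : Finset (Fin d)) (f : MvPowerSeries (Fin d) ℚ) (n : Fin d →₀ ℕ) :
    coeff n (integS A f) =
      if ∀ i ∈ A, n i ≠ 0 then coeff (n - ind A) f / ∏ i ∈ A, (n i : ℚ) else 0 := by
  have key : ∀ l : List (Fin d), l.Nodup → ∀ n : Fin d →₀ ℕ,
      coeff n (l.foldr integ f) =
        if ∀ i ∈ l.toFinset, n i ≠ 0 then
          coeff (n - ind l.toFinset) f / ∏ i ∈ l.toFinset, (n i : ℚ) else 0 := by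
    intro l
    induction l with
    | nil =>
      intro _ n
      have : ind (∅ : Finset (Fin d)) = 0 := by ext; simp
      simp [this]
    | cons i l ih =>
      intro hl n
      rw [List.nodup_cons] at hl
      have hi : i ∉ l.toFinset := by simpa using hl.1
      change (if n i = 0 then 0 else coeff (n - Finsupp.single i 1) (l.foldr integ f) / (n i : ℚ))
        = _
      have hne : ∀ j ∈ l.toFinset, (n - Finsupp.single i 1 : Fin d →₀ ℕ) j = n j := by
        intro j hj
        have : i ≠ j := fun h => hi (h ▸ hj)
        simp [this]
      have hif : (∀ j ∈ l.toFinset, (n - Finsupp.single i 1 : Fin d →₀ ℕ) j ≠ 0) ↔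
          ∀ j ∈ l.toFinset, n j ≠ 0 :=
        forall₂_congr fun j hj => by rw [hne j hj]
      have hprod : ∏ j ∈ l.toFinset, ((n - Finsupp.single i 1 : Fin d →₀ ℕ) j : ℚ) =
          ∏ j ∈ l.toFinset, (n j : ℚ) := Finset.prod_congr rfl fun j hj => by rw [hne j hj]
      rw [ih hl.2, List.toFinset_cons, ind_insert hi, Finset.prod_insert hi, hprod, tsub_tsub]
      simp only [hif, Finset.forall_mem_insert]
      by_cases h : n i = 0
      · simp [h]
      · simp only [h, if_false, ne_eq, not_false_eq_true, true_and]
        split_ifs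
        · rw [div_div, mul_comm]
        · simp
  rw [integS, key _ (Finset.sort_nodup _ _), Finset.sort_toFinset]

end PowerSeries

end NATdk

namespace NATdk

/-! ### Counting the trees of a given shape, and the coefficients of `L` -/

variable {d k : ℕ}

theorem NAT.mem_full {T : NAT d k} {v : List (Dir d k)} {i : Fin d} :
    v ∈ full T.verts i ↔ (T.label v i).isSome := (T.label_isSome v i).symm

/-- Distinct labels filling an interval from `1` put the vertices in bijection with `1, …, n`; the
shift by one passes to `Fin n`. -/
theorem NAT.exists_increasing (T : NAT d k) (i : Fin d) :
    ∃ σ : Increasing (Desc (full T.verts i)) (Nat.card (full T.verts i)),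
      ∀ v, T.label v.1 i = some ((σ.1 v : ℕ) + 1) := by
  have := (finite_full T.verts i).to_subtype
  obtain ⟨n, hn⟩ := T.interval i
  let f : full T.verts i → ℕ := fun v => (T.label v.1 i).get (NAT.mem_full.1 v.2)
  have hf : ∀ v : full T.verts i, T.label v.1 i = some (f v) := fun v => (Option.some_get _).symm
  have hinj : Function.Injective f := by
    intro u v huv
    by_contra hne
    exact T.distinct u.1 u.2.1 v.1 v.2.1 (fun h => hne (Subtype.ext h)) i _ _ (hf u) (hf v) huv
  have hrange : Set.range f = Set.Icc 1 n := by
    rw [← hn]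
    ext a
    constructor
    · rintro ⟨v, rfl⟩
      exact ⟨v.1, v.2.1, hf v⟩
    · rintro ⟨v, -, ha⟩
      have hv : v ∈ full T.verts i := NAT.mem_full.2 (by simp [ha])
      exact ⟨⟨v, hv⟩, Option.some_injective _ ((hf ⟨v, hv⟩).symm.trans ha)⟩
  have hmem : ∀ v, 1 ≤ f v ∧ f v ≤ n := fun v => hrange.subset ⟨v, rfl⟩
  have hcard : Nat.card (full T.verts i) = n := by
    rw [← Set.ncard_univ, ← Set.ncard_image_of_injective _ hinj, Set.image_univ, hrange,
      Set.ncard_eq_toFinset_card']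
    simp
  rw [hcard]
  let g : full T.verts i → Fin n := fun v => ⟨f v - 1, by have := hmem v; omega⟩
  have hg : ∀ v, f v = (g v : ℕ) + 1 := fun v => by have := hmem v; simp only [g]; omega
  have hbij : Function.Bijective g := by
    refine ⟨fun u v huv => hinj (by rw [hg, hg, huv]), fun a => ?_⟩
    obtain ⟨v, hv⟩ : (a : ℕ) + 1 ∈ Set.range f := by rw [hrange]; exact ⟨by omega, a.2⟩
    exact ⟨v, Fin.ext (by have := hg v; omega)⟩
  refine ⟨⟨Equiv.ofBijective g hbij, fun u v huv => ?_⟩, fun v => by rw [hf v, hg v]; rfl⟩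
  have := T.decreasing v.1 v.2.1 u.1 u.2.1 huv.1 huv.2 i _ _ (hf v) (hf u)
  rw [hg, hg] at this
  exact Fin.lt_def.2 (by simpa using this)

/-- Every other vertex descends from the root, which therefore takes the largest label, that is, the
number of labels. So the geometric size depends on the vertices only. -/
theorem NAT.label_nil (T : NAT d k) (i : Fin d) :
    T.label [] i = some (fullSize T.verts i) := by
  have := (finite_full T.verts i).to_subtype
  obtain ⟨σ, hσ⟩ := T.exists_increasing i
  let t : full T.verts i := ⟨[], nil_mem_full T.root_mem i⟩
  change T.label t.1 i = some (Nat.card (full T.verts i))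
  rw [hσ t]
  have hpos : 0 < Nat.card (full T.verts i) := (Nat.zero_le _).trans_lt (σ.1 t).2
  let last : Fin (Nat.card (full T.verts i)) := ⟨Nat.card (full T.verts i) - 1, by omega⟩
  have hlast : ((σ.1 t : Fin _) : ℕ) = last := by
    by_contra hne
    have h : σ.1 (σ.1.symm last) < σ.1 t := by
      refine σ.2 _ _ ⟨List.nil_prefix, fun h => hne ?_⟩
      have : t = σ.1.symm last := Subtype.ext h
      rw [this, Equiv.apply_symm_apply]
    rw [Equiv.apply_symm_apply, Fin.lt_def] at h
    have := (σ.1 t).2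
    simp only [last] at h
    omega
  rw [hlast]
  simp only [last]
  congr 1
  omega

open Classical in
/-- The label that a family of bijections puts on a vertex. -/
noncomputable def labelOf {S : Finset (List (Dir d k))}
    (σ : ∀ i, full S i ≃ Fin (Nat.card (full S i))) (v : List (Dir d k)) (i : Fin d) : Option ℕ :=
  if h : v ∈ full S i then some ((σ i ⟨v, h⟩ : ℕ) + 1) else none

theorem labelOf_eq_some {S : Finset (List (Dir d k))}
    {σ : ∀ i, full S i ≃ Fin (Nat.card (full S i))} {v : List (Dir d k)} {i : Fin d} {a : ℕ} :
    labelOf σ v i = some a ↔ ∃ h : v ∈ full S i, (σ i ⟨v, h⟩ : ℕ) + 1 = a := by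
  rw [labelOf]
  split_ifs with h <;> simp [h]

/-- The tree with given vertices and given orders of its `i`-th labels. -/
noncomputable def natOf {S : Finset (List (Dir d k))} (hS : IsShape S) (h : [] ∈ S)
    (σ : ∀ i, Increasing (Desc (full S i)) (Nat.card (full S i))) : NAT d k where
  verts := S
  label := labelOf fun i => (σ i).1
  root_mem := h
  parent_mem := hS
  label_isSome v i := by
    rw [labelOf]
    split_ifs with h
    · exact iff_of_true rfl h
    · exact iff_of_false (by simp) h
  decreasing v _ u _ hvu hne i a b ha hb := by
    obtain ⟨hv, rfl⟩ := labelOf_eq_some.1 ha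
    obtain ⟨hu, rfl⟩ := labelOf_eq_some.1 hb
    exact Nat.add_lt_add_right ((σ i).2 ⟨u, hu⟩ ⟨v, hv⟩ ⟨hvu, hne⟩) 1
  distinct v _ u _ hne i a b ha hb hab := by
    obtain ⟨hv, rfl⟩ := labelOf_eq_some.1 ha
    obtain ⟨hu, rfl⟩ := labelOf_eq_some.1 hb
    have := (σ i).1.injective (Fin.ext (Nat.add_right_cancel hab))
    exact hne (congrArg Subtype.val this)
  interval i := by
    refine ⟨Nat.card (full S i), ?_⟩
    ext a
    constructor
    · rintro ⟨v, -, ha⟩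
      obtain ⟨hv, rfl⟩ := labelOf_eq_some.1 ha
      exact ⟨Nat.le_add_left _ _, ((σ i).1 ⟨v, hv⟩).2⟩
    · rintro ⟨h₁, h₂⟩
      let b : Fin (Nat.card (full S i)) := ⟨a - 1, by omega⟩
      refine ⟨((σ i).1.symm b).1, ((σ i).1.symm b).2.1, labelOf_eq_some.2
        ⟨((σ i).1.symm b).2, ?_⟩⟩
      rw [Subtype.coe_eta, Equiv.apply_symm_apply]
      simp only [b]
      omega

/-- Choosing a tree with given vertices amounts to choosing the orders of its labels. -/
noncomputable def natEquiv {S : Finset (List (Dir d k))} (hS : IsShape S) (h : [] ∈ S) :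
    (∀ i, Increasing (Desc (full S i)) (Nat.card (full S i))) ≃ {T : NAT d k // T.verts = S} :=
  Equiv.ofBijective (fun σ => ⟨natOf hS h σ, rfl⟩) <| by
    constructor
    · intro σ τ hστ
      funext i
      refine Subtype.ext (Equiv.ext fun v => Fin.ext ?_)
      have h₁ : labelOf (fun i => (σ i).1) = labelOf fun i => (τ i).1 :=
        congrArg (fun T => T.1.label) hστ
      have h₂ := congrFun (congrFun h₁ v.1) i
      simpa [labelOf] using h₂
    · rintro ⟨T, rfl⟩
      choose σ hσ using T.exists_increasing
      refine ⟨σ, Subtype.ext (NAT.ext rfl ?_)⟩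
      funext v i
      change labelOf (fun i => (σ i).1) v i = T.label v i
      rw [labelOf]
      split_ifs with hv
      · exact (hσ i ⟨v, hv⟩).symm
      · rw [NAT.mem_full, Option.not_isSome_iff_eq_none] at hv
        exact hv.symm

theorem finite_nat_of_verts {S : Finset (List (Dir d k))} (hS : IsShape S) (h : [] ∈ S) :
    Finite {T : NAT d k // T.verts = S} := by
  have := fun i => (finite_full S i).to_subtype
  exact Finite.of_equiv _ (natEquiv hS h)

theorem card_nat_of_verts {S : Finset (List (Dir d k))} (hS : IsShape S) (h : [] ∈ S) :
    (Nat.card {T : NAT d k // T.verts = S} : ℚ) =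
      fullWt S * ∏ i, ((fullSize S i).factorial : ℚ) := by
  rw [← Nat.card_congr (natEquiv hS h), Nat.card_pi, fullWt, ← Finset.prod_mul_distrib,
    Nat.cast_prod]
  refine Finset.prod_congr rfl fun i _ => ?_
  exact (div_mul_cancel₀ _ (Nat.cast_ne_zero.2 (Nat.factorial_ne_zero _))).symm

/-- The trees of size `m`, classified by their sets of vertices. -/
def natSigmaEquiv (m : Fin d →₀ ℕ) :
    {T : NAT d k // fullSize T.verts = m} ≃
      Σ S : {S : Finset (List (Dir d k)) // IsShape S ∧ [] ∈ S ∧ fullSize S = m},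
        {T : NAT d k // T.verts = S.1} where
  toFun T := ⟨⟨T.1.verts, T.1.parent_mem, T.1.root_mem, T.2⟩, T.1, rfl⟩
  invFun p := ⟨p.2.1, by rw [p.2.2]; exact p.1.2.2.2⟩
  left_inv _ := rfl
  right_inv := by
    rintro ⟨⟨S, hS⟩, T, hT⟩
    change T.verts = S at hT
    subst hT
    rfl

theorem finite_nat (hk : 1 ≤ k) (hkd : k ≤ d) (m : Fin d →₀ ℕ) :
    Finite {T : NAT d k // fullSize T.verts = m} := by
  have : Finite {S : Finset (List (Dir d k)) // IsShape S ∧ [] ∈ S ∧ fullSize S = m} :=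
    (finite_fullSize hk hkd m).to_subtype
  have := fun S : {S : Finset (List (Dir d k)) // IsShape S ∧ [] ∈ S ∧ fullSize S = m} =>
    finite_nat_of_verts S.2.1 S.2.2.1
  exact Finite.of_equiv _ (natSigmaEquiv m).symm

theorem card_nat (hk : 1 ≤ k) (hkd : k ≤ d) (m : Fin d →₀ ℕ) :
    (Nat.card {T : NAT d k // fullSize T.verts = m} : ℚ) =
      (∑ᶠ S ∈ {S : Finset (List (Dir d k)) | IsShape S ∧ [] ∈ S ∧ fullSize S = m}, fullWt S) *
        ∏ i, ((m i).factorial : ℚ) := by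
  have hfin := finite_fullSize hk hkd m
  have : Finite {S : Finset (List (Dir d k)) // IsShape S ∧ [] ∈ S ∧ fullSize S = m} :=
    hfin.to_subtype
  have := Fintype.ofFinite
    {S : Finset (List (Dir d k)) // IsShape S ∧ [] ∈ S ∧ fullSize S = m}
  have := fun S : {S : Finset (List (Dir d k)) // IsShape S ∧ [] ∈ S ∧ fullSize S = m} =>
    finite_nat_of_verts S.2.1 S.2.2.1
  rw [Nat.card_congr (natSigmaEquiv m), Nat.card_sigma, Nat.cast_sum,
    ← finsum_set_coe_eq_finsum_mem]
  change _ = (∑ᶠ S : {S : Finset (List (Dir d k)) // IsShape S ∧ [] ∈ S ∧ fullSize S = m},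
    fullWt S.1) * _
  rw [finsum_eq_sum_of_fintype, Finset.sum_mul]
  refine Finset.sum_congr rfl fun S _ => ?_
  rw [card_nat_of_verts S.2.1 S.2.2.1, S.2.2.2]

/-- The geometric size as an exponent. -/
noncomputable def sizeExp (T : GNAT d k) : Fin d →₀ ℕ := Finsupp.equivFunOnFinite.symm T.size

theorem sizeExp_empty (π : Dir d k) :
    sizeExp (GNAT.empty π) = ind (Finset.univ \ π.1) := by
  ext i
  by_cases h : i ∈ π.1 <;> simp [sizeExp, GNAT.size, h]

theorem sizeExp_nonempty (T : NAT d k) : sizeExp (GNAT.nonempty T) = fullSize T.verts := by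
  ext i
  simp [sizeExp, GNAT.size, T.label_nil i]

open MvPowerSeries in
theorem coeff_weight (m : Fin d →₀ ℕ) (T : GNAT d k) :
    coeff m (weight T) = if sizeExp T = m then (∏ i, ((m i).factorial : ℚ))⁻¹ else 0 := by
  have h : weight T = monomial (sizeExp T) (∏ i, ((T.size i).factorial : ℚ))⁻¹ := by
    have h₁ : ∀ i, C ((T.size i).factorial : ℚ)⁻¹ * X i ^ T.size i =
        monomial (Finsupp.single i (T.size i)) ((T.size i).factorial : ℚ)⁻¹ := by
      intro i
      rw [X_pow_eq, ← monomial_zero_eq_C_apply, monomial_mul_monomial, zero_add, mul_one]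
    have h₂ : ∑ i, Finsupp.single i (T.size i) = sizeExp T :=
      Finsupp.univ_sum_single (sizeExp T)
    rw [weight, Finset.prod_congr rfl fun i _ => h₁ i, prod_monomial, h₂, Finset.prod_inv_distrib]
  rw [h, coeff_monomial]
  by_cases hm : sizeExp T = m
  · subst hm; simp [sizeExp]
  · rw [if_neg hm, if_neg fun h => hm h.symm]

theorem setOf_sizeExp_eq (m : Fin d →₀ ℕ) :
    {T : GNAT d k | sizeExp T = m} =
      GNAT.empty '' {π | ind (Finset.univ \ π.1) = m} ∪
        GNAT.nonempty '' {T | fullSize T.verts = m} := by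
  ext T
  cases T with
  | empty π => simp [sizeExp_empty]
  | nonempty T => simp [sizeExp_nonempty]

theorem finite_sizeExp (hk : 1 ≤ k) (hkd : k ≤ d) (m : Fin d →₀ ℕ) :
    {T : GNAT d k | sizeExp T = m}.Finite := by
  rw [setOf_sizeExp_eq]
  refine ((Set.toFinite _).image _).union (Set.Finite.image _ ?_)
  exact Set.finite_coe_iff.1 (finite_nat hk hkd m)

open MvPowerSeries in
-- The factor `∏ 1 / m_i!` of the weight cancels the factorials in `card_nat`, leaving a sum of
-- proportions over shapes.
theorem coeff_L (hk : 1 ≤ k) (hkd : k ≤ d) (m : Fin d →₀ ℕ) :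
    coeff m (L d k) = coeff m (∑ π : Dir d k, ∏ i ∈ Finset.univ \ π.1, X i) +
      ∑ᶠ S ∈ {S : Finset (List (Dir d k)) | IsShape S ∧ [] ∈ S ∧ fullSize S = m}, fullWt S := by
  classical
  -- A `finsum` with infinite support is `0`, so finiteness is needed to identify the coefficient.
  have hfin := finite_sizeExp hk hkd m
  have hfin' : {T : NAT d k | fullSize T.verts = m}.Finite :=
    Set.finite_coe_iff.1 (finite_nat hk hkd m)
  have h₁ : coeff m (L d k) =
      ({T : GNAT d k | sizeExp T = m}.ncard : ℚ) * (∏ i, ((m i).factorial : ℚ))⁻¹ := by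
    change ∑ᶠ T : GNAT d k, coeff m (weight T) = _
    have : ∑ᶠ T : GNAT d k, coeff m (weight T) =
        ∑ T ∈ hfin.toFinset, (∏ i, ((m i).factorial : ℚ))⁻¹ := by
      rw [← finsum_mem_eq_finite_toFinset_sum]
      refine finsum_congr fun T => ?_
      rw [coeff_weight, finsum_eq_if]
      rfl
    rw [this, Finset.sum_const, nsmul_eq_mul, Set.ncard_eq_toFinset_card _ hfin]
  have h₂ : ({T : GNAT d k | sizeExp T = m}.ncard : ℚ) =
      {π : Dir d k | ind (Finset.univ \ π.1) = m}.ncard +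
        (Nat.card {T : NAT d k // fullSize T.verts = m} : ℚ) := by
    rw [setOf_sizeExp_eq, Set.ncard_union_eq _ ((Set.toFinite _).image _) (hfin'.image _),
      Set.ncard_image_of_injective _ fun _ _ h => GNAT.empty.inj h,
      Set.ncard_image_of_injective _ fun _ _ h => GNAT.nonempty.inj h, Nat.cast_add]
    · rfl
    · rw [Set.disjoint_left]
      rintro _ ⟨_, _, rfl⟩ ⟨_, _, h⟩
      cases h
  have hne : ∏ i, ((m i).factorial : ℚ) ≠ 0 :=
    Finset.prod_ne_zero_iff.2 fun i _ => Nat.cast_ne_zero.2 (Nat.factorial_ne_zero _)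
  rw [h₁, h₂, card_nat hk hkd, add_mul, mul_inv_cancel_right₀ hne]
  congr 1
  simp only [prod_X_eq, map_sum, coeff_monomial]
  rw [Finset.sum_boole, ← div_eq_mul_inv, div_eq_iff hne]
  have hcard : {π : Dir d k | ind (Finset.univ \ π.1) = m}.ncard =
      (Finset.univ.filter fun π : Dir d k => m = ind (Finset.univ \ π.1)).card := by
    rw [← Set.ncard_coe_finset]
    congr 1
    ext π
    simp [eq_comm]
  rw [hcard]
  -- The size of an empty tree has entries `0` and `1`, whose factorials are `1`.
  by_cases h : ∃ π : Dir d k, m = ind (Finset.univ \ π.1)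
  · have hone : ∏ i, ((m i).factorial : ℚ) = 1 := by
      obtain ⟨π, rfl⟩ := h
      refine Finset.prod_eq_one fun i _ => ?_
      by_cases hi : i ∈ π.1 <;> simp [hi]
    rw [hone, mul_one]
  · have : (Finset.univ.filter fun π : Dir d k => m = ind (Finset.univ \ π.1)) = ∅ :=
      Finset.filter_eq_empty_iff.2 fun π _ hπ => h ⟨π, hπ⟩
    rw [this]; simp

end NATdk

namespace NATdk

/-! ### The functional equations -/

variable {d k : ℕ}

open MvPowerSeries

theorem Dir.exists_mem (hk : 1 ≤ k) (π : Dir d k) : ∃ i, i ∈ π.1 :=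
  Finset.card_pos.1 (by rw [π.2]; omega)

theorem Dir.eq_of_subset {π π' : Dir d k} (h : π.1 ⊆ π'.1) : π = π' :=
  Subtype.ext (Finset.eq_of_subset_of_card_le h (by rw [π.2, π'.2]))

/-- Directions have the same cardinality, so none strictly contains another. Thus `∂_{[d]∖π}` kills
the monomials of the empty trees other than `∅_π`. -/
theorem ind_compl_add_eq {π π' : Dir d k} {n : Fin d →₀ ℕ}
    (h : n + ind (Finset.univ \ π.1) = ind (Finset.univ \ π'.1)) : π = π' ∧ n = 0 := by
  have hπ : π' = π := by
    refine Dir.eq_of_subset fun i hi => ?_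
    by_contra hi'
    have := DFunLike.congr_fun h i
    simp [hi, hi'] at this
  subst hπ
  exact ⟨rfl, by simpa using h⟩

theorem coeff_sum_prod_X (m : Fin d →₀ ℕ) :
    coeff m (∑ π : Dir d k, ∏ i ∈ Finset.univ \ π.1, (X i : MvPowerSeries (Fin d) ℚ)) =
      ∑ π : Dir d k, if m = ind (Finset.univ \ π.1) then 1 else 0 := by
  classical
  simp only [prod_X_eq, map_sum, coeff_monomial]

theorem setOf_hungSize_eq_zero (hk : 1 ≤ k) (π : Dir d k) :
    {S : Finset (List (Dir d k)) | IsShape S ∧ hungSize π S = 0} = {∅} := by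
  ext S
  simp only [Set.mem_ofPred_eq, Set.mem_singleton_iff, hungSize_eq_zero hk]
  exact ⟨fun h => h.2, fun h => ⟨by subst h; intro v π h; simp at h, h⟩⟩

theorem coeff_partialS_L (hk : 1 ≤ k) (hkd : k ≤ d) (π : Dir d k) (n : Fin d →₀ ℕ) :
    coeff n (partialS (Finset.univ \ π.1) (L d k)) =
      ∑ᶠ S ∈ {S : Finset (List (Dir d k)) | IsShape S ∧ hungSize π S = n}, hungWt π S := by
  classical
  rw [coeff_partialS, coeff_L hk hkd, coeff_sum_prod_X]
  -- The constant term comes from `∅_π` alone, since a non-empty tree keeps a root label in `π`. The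
  -- other coefficients come from non-empty trees alone.
  by_cases hn : n = 0
  · subst hn
    have h₂ : {S : Finset (List (Dir d k)) | IsShape S ∧ [] ∈ S ∧
        fullSize S = 0 + ind (Finset.univ \ π.1)} = ∅ := by
      refine Set.eq_empty_of_forall_notMem fun S hS => ?_
      obtain ⟨i, hi⟩ := π.exists_mem hk
      refine fullSize_ne_zero hS.2.1 i ?_
      rw [hS.2.2]
      simp [hi]
    rw [setOf_hungSize_eq_zero hk, h₂, finsum_mem_empty, finsum_mem_singleton, hungWt_empty, add_zero,
      Finset.sum_eq_single_of_mem π (Finset.mem_univ _)]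
    · simp
    · intro π' _ hne
      exact if_neg fun h => hne (ind_compl_add_eq h).1.symm
  · have h₁ : {S : Finset (List (Dir d k)) | IsShape S ∧ [] ∈ S ∧
        fullSize S = n + ind (Finset.univ \ π.1)} =
        {S | IsShape S ∧ hungSize π S = n} := by
      ext S
      simp only [Set.mem_ofPred_eq]
      refine and_congr_right fun hS => ?_
      have key : [] ∈ S → (fullSize S = n + ind (Finset.univ \ π.1) ↔ hungSize π S = n) := by
        intro h
        have : fullSize S = hungSize π S + ind (Finset.univ \ π.1) := by
          ext i
          rw [fullSize_eq_hungSize h π i]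
          by_cases hi : i ∈ π.1 <;> simp [hi]
        rw [this, add_left_inj]
      refine ⟨fun h => (key h.1).1 h.2, fun h => ?_⟩
      have hne : S.Nonempty := by
        rw [Finset.nonempty_iff_ne_empty]
        rintro rfl
        exact hn (h.symm.trans (hungSize_empty π))
      exact ⟨hS.nil_mem hne, (key (hS.nil_mem hne)).2 h⟩
    rw [Finset.sum_eq_zero fun π' _ => if_neg fun h => hn (ind_compl_add_eq h).2, zero_add, ← h₁]
    rw [finsum_mem_eq_finite_toFinset_sum _ (finite_fullSize hk hkd _),
      finsum_mem_eq_finite_toFinset_sum _ (finite_fullSize hk hkd _), Finset.sum_mul]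
    refine Finset.sum_congr rfl fun S hS => ?_
    rw [Set.Finite.mem_toFinset] at hS
    rw [← fullWt_eq_hungWt hS.2.1 π, hS.2.2]
    congr 1
    refine Finset.prod_congr rfl fun i hi => ?_
    rw [Finsupp.add_apply, ind_apply, if_pos hi]
    push_cast
    rfl

theorem L_eq (hk : 1 ≤ k) (hkd : k ≤ d) :
    L d k = (∑ π : Dir d k, ∏ i ∈ Finset.univ \ π.1, X i) +
      integS Finset.univ (∏ π : Dir d k, partialS (Finset.univ \ π.1) (L d k)) := by
  classical
  ext m
  rw [coeff_L hk hkd, map_add, coeff_integS]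
  congr 1
  split_ifs with hm
  · have hm' : m = m - ind Finset.univ + ind Finset.univ := by
      ext i
      have := hm i (Finset.mem_univ i)
      simp only [Finsupp.add_apply, Finsupp.tsub_apply, ind_apply, Finset.mem_univ, if_true]
      omega
    set n := m - ind Finset.univ
    rw [coeff_prod_of_finite_fibers (p := IsShape) (s := hungSize) (c := hungWt)
      (finite_hungSize hk) (coeff_partialS_L hk hkd)]
    have hb := bijOn_subtree (k := k) n
    rw [← ind_univ, ← hm'] at hb
    have hfin := finite_fullSize hk hkd m
    rw [← finsum_mem_eq_of_bijOn (f := fun S => ∏ π, hungWt π (subtree S π)) subtree hb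
        fun _ _ => rfl,
      finsum_mem_eq_finite_toFinset_sum _ hfin, finsum_mem_eq_finite_toFinset_sum _ hfin,
      Finset.sum_div]
    refine Finset.sum_congr rfl fun S hS => ?_
    rw [Set.Finite.mem_toFinset] at hS
    rw [fullWt_eq_prod hS.2.1, hS.2.2]
  · have : {S : Finset (List (Dir d k)) | IsShape S ∧ [] ∈ S ∧ fullSize S = m} = ∅ := by
      refine Set.eq_empty_of_forall_notMem fun S hS => hm fun i _ => ?_
      rw [← hS.2.2]
      exact fullSize_ne_zero hS.2.1 i
    rw [this, finsum_mem_empty]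

theorem G_eq_prod_partialS (hk : 1 ≤ k) (hkd : k ≤ d) :
    G d k = ∏ π : Dir d k, partialS (Finset.univ \ π.1) (L d k) := by
  classical
  ext n
  have hpos : ∀ i, (n + ind Finset.univ : Fin d →₀ ℕ) i = n i + 1 := fun i => by simp
  -- Only the outer `L` on the left is to be expanded: `map_add` splits that sum, and the reverse
  -- rewriting restores `L` inside the product.
  rw [G, coeff_partialS, L_eq hk hkd, map_add, ← L_eq hk hkd, coeff_integS,
    if_pos fun i _ => by rw [hpos]; omega, coeff_sum_prod_X, add_tsub_cancel_right,
    Finset.sum_eq_zero, zero_add]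
  · simp only [hpos, Nat.cast_add, Nat.cast_one]
    exact div_mul_cancel₀ _ (Finset.prod_ne_zero_iff.2 fun i _ => by positivity)
  · intro π _
    refine if_neg fun h => ?_
    obtain ⟨i, hi⟩ := π.exists_mem hk
    have := DFunLike.congr_fun h i
    rw [hpos] at this
    simp [hi] at this

/-- Applying `∂_π` to the left side gives `G`, and `∫_π` recovers every monomial containing all
variables of `π`. The only other monomial is the constant `1`, as the root of a non-empty tree has a
label at each `i ∈ π`. -/
theorem partialS_L_eq (hk : 1 ≤ k) (hkd : k ≤ d) (π : Dir d k) :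
    partialS (Finset.univ \ π.1) (L d k) = 1 + integS π.1 (G d k) := by
  classical
  ext n
  rw [map_add, coeff_integS, coeff_one]
  split_ifs with h₀ h₁ h₁
  · obtain ⟨i, hi⟩ := π.exists_mem hk
    exact absurd (by simp [h₀]) (h₁ i hi)
  · subst h₀
    rw [coeff_partialS_L hk hkd, setOf_hungSize_eq_zero hk, finsum_mem_singleton, hungWt_empty, add_zero]
  · rw [G, coeff_partialS, coeff_partialS, zero_add]
    have hn : n - ind π.1 + ind Finset.univ = n + ind (Finset.univ \ π.1) := by
      ext i
      simp only [Finsupp.add_apply, Finsupp.tsub_apply, ind_apply, Finset.mem_univ, if_true,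
        Finset.mem_sdiff, true_and]
      by_cases hi : i ∈ π.1
      · have := h₁ i hi
        simp only [hi, if_true, not_true, if_false]
        omega
      · simp [hi]
    have hprod : ∏ i, (((n - ind π.1 : Fin d →₀ ℕ) i : ℚ) + 1) =
        (∏ i ∈ Finset.univ \ π.1, ((n i : ℚ) + 1)) * ∏ i ∈ π.1, (n i : ℚ) := by
      rw [← Finset.prod_sdiff (Finset.subset_univ π.1)]
      congr 1
      · refine Finset.prod_congr rfl fun i hi => ?_
        have hi : i ∉ π.1 := by simpa using hi
        simp [hi]
      · refine Finset.prod_congr rfl fun i hi => ?_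
        have h := h₁ i hi
        rw [Finsupp.tsub_apply, ind_apply, if_pos hi]
        exact_mod_cast Nat.sub_add_cancel (Nat.one_le_iff_ne_zero.2 h)
    have hne : ∏ i ∈ π.1, (n i : ℚ) ≠ 0 :=
      Finset.prod_ne_zero_iff.2 fun i hi => Nat.cast_ne_zero.2 (h₁ i hi)
    rw [hn, hprod, ← mul_assoc, mul_div_cancel_right₀ _ hne]
  · rw [coeff_partialS_L hk hkd, add_zero]
    refine finsum_mem_of_eqOn_zero fun S hS => ?_
    exfalso
    have hne : S.Nonempty := by
      rw [Finset.nonempty_iff_ne_empty]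
      rintro rfl
      exact h₀ (hS.2.symm.trans (hungSize_empty π))
    have hnil := hS.1.nil_mem hne
    refine h₁ fun i hi => ?_
    have := fullSize_ne_zero hnil i
    rwa [fullSize_eq_hungSize hnil π, if_pos hi, add_zero, hS.2] at this

end NATdk

theorem mainTheorem7 (d k : ℕ) (hk : 1 ≤ k) (hkd : k ≤ d) :
    (∀ m : Fin d →₀ ℕ,
      {T : NATdk.GNAT d k | MvPowerSeries.coeff m (NATdk.weight T) ≠ 0}.Finite) ∧
    NATdk.L d k =
      (∑ π : NATdk.Dir d k, ∏ i ∈ Finset.univ \ π.1, MvPowerSeries.X i) +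
        NATdk.integS Finset.univ
          (∏ π : NATdk.Dir d k, NATdk.partialS (Finset.univ \ π.1) (NATdk.L d k)) ∧
    NATdk.G d k = ∏ π : NATdk.Dir d k, (1 + NATdk.integS π.1 (NATdk.G d k)) := by
  refine ⟨fun m => (NATdk.finite_sizeExp hk hkd m).subset fun T hT => ?_, NATdk.L_eq hk hkd, ?_⟩
  · by_contra h
    exact hT ((NATdk.coeff_weight m T).trans (if_neg h))
  · exact (NATdk.G_eq_prod_partialS hk hkd).trans
      (Finset.prod_congr rfl fun π _ => NATdk.partialS_L_eq hk hkd π)
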